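/- **Setting.** Let $(X,d)$ be a complete geodesic metric space with a locally finite Borel measure $\mu$ of full support that is doubling ($\mu(B(x,2r))\le C_d\,\mu(B(x,r))$ for all $x\in X$, $r>0$) and supports a $2$-Poincaré inequality: there is a constant $C_P$ such that for every ball $B$ of radius $\rho$, every $u:X\to\mathbb R$ integrable on balls and every upper gradient $g$ of $u$, $$\frac1{\mu(B)}\int_B|u-u_B|\,d\mu\le C_P\,\rho\Big(\frac1{\mu(B)}\int_B g^2\,d\mu\Big)^{1/2},$$ where $u_B$ is the mean of $u$ over $B$. A Borel function $g:X\to[0,\infty]$ is an upper gradient of $u$ if $|u(y)-u(x)|\le\int_\gamma g\,ds$ for every non-constant compact rectifiable curve $\gamma$ with end points $x,y$. The space $N^{1,2}(X)$ consists of the functions $u:X\to\mathbb R$ in $L^2(X)$ that have an upper gradient in $L^2(X)$, with $\|u\|_{N^{1,2}}^2=\int_X|u|^2d\mu+\inf_g\int_Xg^2d\mu$, the infimum over all upper gradients $g$ of $u$. For $\Omega\subset X$, $N^{1,2}_0(\Omega)$ is the set of $f\in N^{1,2}(X)$ with $f=0$ on $X\setminus\Omega$. For each $r>0$ let $X_r\subset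 X$ be a set whose distinct points have distance at least $r$ and with $X=\bigcup_{x\in X_r}B(x,r)$. For distinct $x,y\in X_r$ write $x\sim y$ if $B(x,2r)\cap B(y,2r)\neq\emptyset$. For $u\in N^{1,2}(X)$ let $u_r(x)$ be the mean of $u$ over $B(x,r/4)$ and $$\mathcal E_r[u]=\sum_{x\in X_r}\sum_{y\sim x}\frac{|u_r(y)-u_r(x)|^2}{r^2}\,\mu(B(x,2r)).$$ Let $r_k>0$ with $r_k\to0$ be such that $\mathcal E_{r_k}$ $\Gamma$-converges to $\mathcal E$ on $N^{1,2}(X)$, i.e. $\mathcal E[u]\le\liminf_k\mathcal E_{r_k}[w_k]$ whenever $w_k\to u$ in $N^{1,2}(X)$, and every $u\in N^{1,2}(X)$ admits $w_k\to u$ in $N^{1,2}(X)$ with $\limsup_k\mathcal E_{r_k}[w_k]\le\mathcal E[u]$. **Theorem 1.2.** Let $u\in N^{1,2}(X)$ and let $\Omega\subset X$ be a domain (a nonempty connected open set). Suppose $v_j\to u$ in $N^{1,2}(X)$ and $\mathcal E[u]=\lim_{j\to\infty}\mathcal E_{r_j}[v_j]$. Then there are $u_j\in N^{1,2}(X)$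 with $$\mathcal E[u]=\lim_{j\to\infty}\mathcal E_{r_j}[u_j],\qquad u-u_j\in N^{1,2}_0(\Omega)\ \text{ for all } j,\qquad u_j\to u\ \text{ in } N^{1,2}(X).$$ Moreover, if $\Omega\ne X$ and $\mu(\Omega)<\infty$ (for instance if $X$ is compact and $\Omega\neq X$), one can take $u_j=\min\{\max\{u-w,\,v_j\},\,u+w\}$ with $w=\operatorname{dist}(\cdot,X\setminus\Omega)$. -/

import Mathlib

open MeasureTheory Filter Topology Metric Set
open scoped ENNReal NNReal

noncomputable section

namespace GraphDirichlet

section Space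

variable {X : Type*} [MetricSpace X]

/-- Any two points are joined by a curve whose length is their distance, that is,
by an isometric image of the interval `[0, d(x, y)]`. -/
def IsGeodesicSpace (X : Type*) [MetricSpace X] : Prop :=
  ∀ x y : X, ∃ γ : ℝ → X, γ 0 = x ∧ γ (dist x y) = y ∧
    ∀ s ∈ Icc 0 (dist x y), ∀ t ∈ Icc 0 (dist x y), dist (γ s) (γ t) = |s - t|

/-- `A` is a maximal `r`-separated set: its points have mutual distance at least `r`, and
the balls of radius `r` around them cover the space. -/
def IsNet (r : ℝ) (A : Set X) : Prop :=
  (∀ x ∈ A, ∀ y ∈ A, x ≠ y → r ≤ dist x y) ∧ ∀ z : X, ∃ x ∈ A, z ∈ ball x r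

/-- The graph on the vertex set `A` in which distinct `x`, `y` are neighbours when the balls
`B(x, 2r)` and `B(y, 2r)` intersect. -/
def netGraph (r : ℝ) (A : Set X) : SimpleGraph A where
  Adj x y := x ≠ y ∧ (ball (x : X) (2 * r) ∩ ball (y : X) (2 * r)).Nonempty
  symm := ⟨fun _ _ h => ⟨h.1.symm, by rw [inter_comm]; exact h.2⟩⟩
  loopless := ⟨fun _ h => h.1 rfl⟩

/-- A domain: a nonempty connected open set. -/
def IsDomainSet (Ω : Set X) : Prop := IsOpen Ω ∧ IsConnected Ω

end Space

section Sobolev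

variable {X : Type*} [MetricSpace X] [MeasurableSpace X]

/-- The measure `μ` is doubling. -/
def IsDoubling (μ : Measure X) : Prop :=
  ∃ C : ℝ≥0, ∀ (x : X) (r : ℝ), 0 < r → μ (ball x (2 * r)) ≤ C * μ (ball x r)

/-- `g` is an upper gradient of `u`: it is a Borel function with values in `[0, ∞]`, and
`|u(γ(L)) - u(γ(0))| ≤ ∫_γ g ds` for every non-constant compact rectifiable curve `γ`. The
integral over `γ` is by definition taken in the arc-length parametrization, so `γ` runs
through the curves parametrized by arc length on an interval `[0, L]`, `L > 0`. -/
def IsUpperGradient (u : X → ℝ) (g : X → ℝ≥0∞) : Prop :=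
  Measurable g ∧ ∀ (L : ℝ) (γ : ℝ → X), 0 < L → HasUnitSpeedOn γ (Icc 0 L) →
    ENNReal.ofReal |u (γ L) - u (γ 0)| ≤ ∫⁻ t in Icc 0 L, g (γ t)

/-- The upper gradient energy: the infimum of `∫ g² dμ` over all upper gradients `g` of `u`. -/
def upperEnergy (μ : Measure X) (u : X → ℝ) : ℝ≥0∞ :=
  ⨅ (g : X → ℝ≥0∞) (_ : IsUpperGradient u g), ∫⁻ x, g x ^ 2 ∂μ

/-- The Newton-Sobolev class `N^{1,2}(X)`: (everywhere defined) functions in `L²` with an upper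
gradient in `L²`. -/
def N12 (μ : Measure X) : Set (X → ℝ) :=
  {u | MemLp u 2 μ ∧ ∃ g, IsUpperGradient u g ∧ ∫⁻ x, g x ^ 2 ∂μ < ∞}

/-- The (semi)norm of `N^{1,2}(X)`: the square root of `∫ |u|² dμ + inf_g ∫ g² dμ`. -/
def N12norm (μ : Measure X) (u : X → ℝ) : ℝ≥0∞ :=
  ((∫⁻ x, ENNReal.ofReal (|u x| ^ 2) ∂μ) + upperEnergy μ u) ^ (1 / 2 : ℝ)

/-- `v j → u` in `N^{1,2}(X)`. -/
def TendstoN12 (μ : Measure X) (v : ℕ → X → ℝ) (u : X → ℝ) : Prop :=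
  (∀ j, v j ∈ N12 μ) ∧ u ∈ N12 μ ∧ Tendsto (fun j => N12norm μ (v j - u)) atTop (𝓝 0)

/-- The class `N^{1,2}_0(Ω)` of functions in `N^{1,2}(X)` that vanish outside `Ω`. -/
def N12zero (μ : Measure X) (Ω : Set X) : Set (X → ℝ) :=
  {f | f ∈ N12 μ ∧ ∀ x ∉ Ω, f x = 0}

/-- The `2`-Poincaré inequality (with the same ball on both sides), for all functions that are
integrable on balls and all their upper gradients. -/
def SupportsPoincare (μ : Measure X) : Prop :=
  ∃ C : ℝ≥0, ∀ (u : X → ℝ) (g : X → ℝ≥0∞),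
    (∀ (x : X) (r : ℝ), IntegrableOn u (ball x r) μ) → IsUpperGradient u g →
    ∀ (x : X) (r : ℝ), 0 < r →
      ⨍⁻ y in ball x r, ENNReal.ofReal |u y - ⨍ z in ball x r, u z ∂μ| ∂μ ≤
        C * ENNReal.ofReal r * (⨍⁻ y in ball x r, g y ^ 2 ∂μ) ^ (1 / 2 : ℝ)

/-- The discretization `u_r(x)`: the mean value of `u` over `B(x, r/4)`. -/
def discretize (μ : Measure X) (r : ℝ) (u : X → ℝ) (x : X) : ℝ :=
  ⨍ y in ball x (r / 4), u y ∂μ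

/-- The approximating energy `𝓔_r[u]`: the sum, over vertices `x` of the graph at scale `r` and
neighbours `y` of `x`, of `|u_r(y) - u_r(x)|² / r² · μ(B(x, 2r))`. -/
def netEnergy (μ : Measure X) (r : ℝ) (A : Set X) (u : X → ℝ) : ℝ≥0∞ :=
  ∑' x : A, ∑' y : (netGraph r A).neighborSet x,
    ENNReal.ofReal (|discretize μ r u (y : A) - discretize μ r u x| ^ 2 / r ^ 2) *
      μ (ball (x : X) (2 * r))

/-- The energies `F k` `Γ`-converge to `E` on `N^{1,2}(X)`. -/
def GammaConverges (μ : Measure X) (F : ℕ → (X → ℝ) → ℝ≥0∞) (E : (X → ℝ) → ℝ≥0∞) : Prop :=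
  (∀ u ∈ N12 μ, ∀ v : ℕ → X → ℝ, TendstoN12 μ v u →
    E u ≤ liminf (fun k => F k (v k)) atTop) ∧
  (∀ u ∈ N12 μ, ∃ v : ℕ → X → ℝ, TendstoN12 μ v u ∧
    limsup (fun k => F k (v k)) atTop ≤ E u)

end Sobolev

end GraphDirichlet

end

/-!
The square root of the discrete energy at scale `r` is an `ℓ²` seminorm, and the Poincaré
inequality together with doubling bounds it by the upper gradient energy uniformly in `r`
(`exists_netEnergy_le`): two neighbouring means over balls of radius `r/4` are compared with the
mean over `B(x, 5r)`, and these larger balls have bounded overlap. Minkowski's inequality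
(`sqrt_netEnergy_le_add`) then shows that the discrete energies along any two sequences with the
same limit in `N^{1,2}(X)` have the same limit (`tendsto_netEnergy_iff`). It therefore suffices to
modify `v j` to a sequence which agrees with `u` off `Ω` and still converges to `u` in `N^{1,2}(X)`.

With `f = v j - u` and `w = dist(·, X ∖ Ω)`, the modified function differs from `u` by the
truncation of `f` to `[-w, w]`, which is smaller than `|f|` and vanishes off `Ω`. If `g` is an upper
gradient of `f`, then `g + 1_A` is one of the truncation, where `A ⊇ {0 < w ≤ |f|}` is Borel
(`IsUpperGradient.clamp`): along a curve the truncation equals `f` where `|f| < w`, it vanishes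
where `w = 0`, and it moves by at most `∫ (g + 1)` on the remaining set. Finally
`μ {0 < w ≤ |f|} → 0` as `f → 0` in `L²`, since `{w > 0}` has finite measure
(`tendsto_measure_active_zero`). If `μ(Ω) = ∞`, the truncation is performed on the intersection of
`Ω` with a ball; if `Ω = X`, nothing has to be modified.
-/

noncomputable section

namespace GraphDirichlet

/-! ### Truncation along curves -/

/-- The value `f` truncated to the interval `[-w, w]`. -/
def clamp (w f : ℝ) : ℝ := min (max (-w) f) w

theorem clamp_zero_left (f : ℝ) : clamp 0 f = 0 := by
  simp only [clamp, neg_zero]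
  exact min_eq_right (le_max_left _ _)

theorem abs_clamp_le_abs {w : ℝ} (hw : 0 ≤ w) (f : ℝ) : |clamp w f| ≤ |f| := by
  unfold clamp
  grind

theorem abs_clamp_le {w : ℝ} (hw : 0 ≤ w) (f : ℝ) : |clamp w f| ≤ w := by
  unfold clamp
  grind

theorem clamp_of_abs_le {w f : ℝ} (h : |f| ≤ w) : clamp w f = f := by
  unfold clamp
  grind

theorem abs_clamp_sub_clamp_le (w f w' f' : ℝ) :
    |clamp w f - clamp w' f'| ≤ max |f - f'| |w - w'| := by
  unfold clamp
  refine (abs_min_sub_min_le_max _ _ _ _).trans (max_le ?_ (le_max_right _ _))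
  refine (abs_max_sub_max_le_max _ _ _ _).trans (max_le ?_ (le_max_left _ _))
  rw [show -w - -w' = -(w - w') by ring, abs_neg]
  exact le_max_right _ _

/-- Subtracting the truncation to `[-δ, δ]` is a `1`-Lipschitz operation. -/
theorem abs_sub_clamp_sub_le (δ x y : ℝ) :
    |(x - clamp δ x) - (y - clamp δ y)| ≤ |x - y| := by
  unfold clamp
  grind

/-- An increment bound by a measure holds on an interval as soon as it holds on all small
subintervals. -/
theorem ofReal_abs_sub_le_of_locally {φ : ℝ → ℝ} {ν : Measure ℝ} {a b : ℝ} (hab : a ≤ b)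
    (h : ∀ t ∈ Icc a b, ∃ O ∈ 𝓝[Icc a b] t, ∀ s s', s ≤ s' → Icc s s' ⊆ O ∩ Icc a b →
      ENNReal.ofReal |φ s' - φ s| ≤ ν (Ioc s s')) :
    ENNReal.ofReal |φ b - φ a| ≤ ν (Ioc a b) := by
  have h' : ∀ t : Icc a b, ∃ O : Set ℝ, IsOpen O ∧ (t : ℝ) ∈ O ∧
      ∀ s s', s ≤ s' → Icc s s' ⊆ O ∩ Icc a b → ENNReal.ofReal |φ s' - φ s| ≤ ν (Ioc s s') := by
    rintro ⟨t, ht⟩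
    obtain ⟨O, hO, hOs⟩ := h t ht
    obtain ⟨O', hO'o, hO't, hO'⟩ := mem_nhdsWithin.1 hO
    exact ⟨O', hO'o, hO't, fun s s' hss hs =>
      hOs s s' hss fun x hx => ⟨hO' (hs hx), (hs hx).2⟩⟩
  choose O hOo hOt hO using h'
  obtain ⟨t, ht0, htm, ⟨m, hm⟩, hc⟩ := exists_monotone_Icc_subset_open_cover_Icc hab
    (c := fun i => ((↑) : Icc a b → ℝ) ⁻¹' O i)
    (fun i => (hOo i).preimage continuous_subtype_val)
    (fun x _ => mem_iUnion.2 ⟨x, hOt x⟩)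
  have step : ∀ n, ENNReal.ofReal |φ (t n) - φ a| ≤ ν (Ioc a (t n)) := by
    intro n
    induction n with
    | zero => simp [ht0]
    | succ n ih =>
      obtain ⟨i, hi⟩ := hc n
      have hle : (t n : ℝ) ≤ t (n + 1) := htm n.le_succ
      have h2 := hO i (t n) (t (n + 1)) hle (fun x hx => by
        have hx' : x ∈ Icc a b := ⟨(t n).2.1.trans hx.1, hx.2.trans (t (n + 1)).2.2⟩
        exact ⟨@hi ⟨x, hx'⟩ ⟨hx.1, hx.2⟩, hx'⟩)
      calc ENNReal.ofReal |φ (t (n + 1)) - φ a|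
          ≤ ENNReal.ofReal (|φ (t n) - φ a| + |φ (t (n + 1)) - φ (t n)|) := by
            apply ENNReal.ofReal_le_ofReal
            exact (abs_sub_le _ (φ (t n)) _).trans_eq (add_comm _ _)
        _ = ENNReal.ofReal |φ (t n) - φ a| + ENNReal.ofReal |φ (t (n + 1)) - φ (t n)| :=
            ENNReal.ofReal_add (abs_nonneg _) (abs_nonneg _)
        _ ≤ ν (Ioc a (t n)) + ν (Ioc (t n) (t (n + 1))) := add_le_add ih h2
        _ = ν (Ioc a (t (n + 1))) := by
            rw [← Ioc_union_Ioc_eq_Ioc (t n).2.1 hle,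
              measure_union (Set.disjoint_left.2 fun x hx hx' => hx'.1.not_ge hx.2) measurableSet_Ioc]
  have := step m
  rwa [hm m le_rfl] at this

/-- The one-dimensional core of the truncation argument: if `F` has density `G` and `W` is
`1`-Lipschitz, the truncation of `F` to `[-W, W]` has density `G` off the set where it is active,
and density at most `G + 1` there. -/
theorem ofReal_abs_clamp_sub_clamp_le {F W : ℝ → ℝ} {G : ℝ → ℝ≥0∞} {L : ℝ} (hL : 0 ≤ L)
    (hFc : ContinuousOn F (Icc 0 L)) (hW0 : ∀ t, 0 ≤ W t)
    (hF : ∀ s t, 0 ≤ s → s ≤ t → t ≤ L → ENNReal.ofReal |F t - F s| ≤ ∫⁻ x in Ioc s t, G x)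
    (hW : ∀ s t, 0 ≤ s → s ≤ t → t ≤ L → |W t - W s| ≤ t - s) :
    ENNReal.ofReal |clamp (W L) (F L) - clamp (W 0) (F 0)| ≤
      (∫⁻ x in Icc 0 L, G x) + volume {t ∈ Icc 0 L | 0 < W t ∧ W t ≤ |F t|} := by
  set S := {t ∈ Icc 0 L | 0 < W t ∧ W t ≤ |F t|} with hS
  have hWc : ContinuousOn W (Icc 0 L) := by
    refine (LipschitzOnWith.of_dist_le_mul (K := 1) ?_).continuousOn
    intro x hx y hy
    rw [Real.dist_eq, Real.dist_eq, NNReal.coe_one, one_mul]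
    rcases le_total x y with h | h
    · rw [abs_sub_comm, abs_sub_comm x, abs_of_nonneg (sub_nonneg.2 h)]
      exact hW x y hx.1 h hy.2
    · rw [abs_of_nonneg (sub_nonneg.2 h)]
      exact hW y x hy.1 h hx.2
  refine ENNReal.le_of_forall_pos_le_add fun ε hε _ => ?_
  obtain ⟨δ, hδ, hδε⟩ : ∃ δ : ℝ, 0 < δ ∧ 3 * δ = ε := ⟨ε / 3, by positivity, by ring⟩
  obtain ⟨U, hSU, hU, hUv⟩ := S.exists_isOpen_le_add volume (ε := ENNReal.ofReal δ)
    (by simpa using hδ)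
  set ν : Measure ℝ := volume.withDensity G + volume.restrict U with hν
  have hGν : ∀ s t, ∫⁻ x in Ioc s t, G x ≤ ν (Ioc s t) := fun s t => by
    rw [hν, Measure.add_apply, withDensity_apply _ measurableSet_Ioc]
    exact le_self_add
  -- The truncation is shrunk by `δ`, which makes it vanish near the zeros of `W`. The interval is
  -- then covered by the relatively open sets `{W < δ}` and `{|F| < W}` and the neighbourhood `U`
  -- of the remaining points, all of which lie in `S`.
  set H : ℝ → ℝ := fun t => clamp (W t) (F t) with hH
  set φ : ℝ → ℝ := fun t => H t - clamp δ (H t) with hφ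
  have hφH : ∀ s t, |φ t - φ s| ≤ |H t - H s| := fun s t => abs_sub_clamp_sub_le _ _ _
  have hloc : ENNReal.ofReal |φ L - φ 0| ≤ ν (Ioc 0 L) := by
    refine ofReal_abs_sub_le_of_locally hL fun t ht => ?_
    rcases lt_or_ge (W t) δ with h1 | h1
    · refine ⟨{x | W x < δ}, (hWc t ht).eventually (gt_mem_nhds h1), fun s s' hss hs => ?_⟩
      have hz : ∀ x, W x < δ → φ x = 0 := fun x hx => by
        simp only [hφ]
        rw [clamp_of_abs_le ((abs_clamp_le (hW0 x) _).trans hx.le), sub_self]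
      rw [hz s (hs (left_mem_Icc.2 hss)).1, hz s' (hs (right_mem_Icc.2 hss)).1]
      simp
    rcases lt_or_ge (|F t|) (W t) with h2 | h2
    · refine ⟨{x | |F x| < W x}, ?_, fun s s' hss hs => ?_⟩
      · exact Filter.Tendsto.eventually_lt (hFc t ht).abs (hWc t ht) h2
      · have hs0 := hs (left_mem_Icc.2 hss)
        have hs1 := hs (right_mem_Icc.2 hss)
        have e0 : H s = F s := clamp_of_abs_le hs0.1.le
        have e1 : H s' = F s' := clamp_of_abs_le hs1.1.le
        refine (ENNReal.ofReal_le_ofReal (hφH s s')).trans ?_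
        rw [e0, e1]
        exact (hF s s' hs0.2.1 hss hs1.2.2).trans (hGν _ _)
    · refine ⟨U, mem_nhdsWithin_of_mem_nhds (hU.mem_nhds (hSU ⟨ht, hδ.trans_le h1, h2⟩)),
        fun s s' hss hs => ?_⟩
      have hs0 := (hs (left_mem_Icc.2 hss)).2
      have hs1 := (hs (right_mem_Icc.2 hss)).2
      have hsU : Ioc s s' ⊆ U := fun x hx => (hs (Ioc_subset_Icc_self hx)).1
      have hνe : ν (Ioc s s') = (∫⁻ x in Ioc s s', G x) + ENNReal.ofReal (s' - s) := by
        rw [hν, Measure.add_apply, withDensity_apply _ measurableSet_Ioc,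
          Measure.restrict_apply measurableSet_Ioc, inter_eq_left.2 hsU, Real.volume_Ioc]
      calc ENNReal.ofReal |φ s' - φ s|
          ≤ ENNReal.ofReal (|F s' - F s| + |W s' - W s|) := by
            refine ENNReal.ofReal_le_ofReal ((hφH s s').trans
              ((abs_clamp_sub_clamp_le _ _ _ _).trans ?_))
            exact max_le (le_add_of_nonneg_right (abs_nonneg _))
              (le_add_of_nonneg_left (abs_nonneg _))
        _ = ENNReal.ofReal |F s' - F s| + ENNReal.ofReal |W s' - W s| :=
            ENNReal.ofReal_add (abs_nonneg _) (abs_nonneg _)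
        _ ≤ _ := by
            rw [hνe]
            exact add_le_add (hF s s' hs0.1 hss hs1.2)
              (ENNReal.ofReal_le_ofReal (hW s s' hs0.1 hss hs1.2))
  have hνL : ν (Ioc 0 L) ≤ (∫⁻ x in Icc 0 L, G x) + (volume S + ENNReal.ofReal δ) := by
    rw [hν, Measure.add_apply, withDensity_apply _ measurableSet_Ioc]
    refine add_le_add (lintegral_mono_set Ioc_subset_Icc_self) ?_
    exact (measure_mono (subset_univ _)).trans ((Measure.restrict_apply_univ U).le.trans hUv)
  have hclose : ∀ t, |H t - φ t| ≤ δ := fun t => by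
    simp only [hφ, sub_sub_cancel]
    exact abs_clamp_le hδ.le _
  have htri : |H L - H 0| ≤ |φ L - φ 0| + 2 * δ := by
    have h1 := hclose L
    have h2 := hclose 0
    rw [abs_le] at h1 h2 ⊢
    have h3 := abs_le.1 (le_refl |φ L - φ 0|)
    constructor <;> linarith
  calc ENNReal.ofReal |H L - H 0|
      ≤ ENNReal.ofReal (|φ L - φ 0| + 2 * δ) := ENNReal.ofReal_le_ofReal htri
    _ = ENNReal.ofReal |φ L - φ 0| + ENNReal.ofReal (2 * δ) :=
        ENNReal.ofReal_add (abs_nonneg _) (by positivity)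
    _ ≤ (∫⁻ x in Icc 0 L, G x) + (volume S + ENNReal.ofReal δ) + ENNReal.ofReal (2 * δ) :=
        add_le_add (hloc.trans hνL) le_rfl
    _ = (∫⁻ x in Icc 0 L, G x) + volume S + ENNReal.ofReal (δ + 2 * δ) := by
        rw [ENNReal.ofReal_add hδ.le (by positivity)]
        ring
    _ = (∫⁻ x in Icc 0 L, G x) + volume S + ε := by
        rw [show δ + 2 * δ = ε by linarith, ENNReal.ofReal_coe_nnreal]

section UpperGradient

variable {X : Type*} [MetricSpace X]

theorem dist_le_of_hasUnitSpeedOn {γ : ℝ → X} {I : Set ℝ} (hγ : HasUnitSpeedOn γ I) {s t : ℝ}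
    (hs : s ∈ I) (ht : t ∈ I) (hst : s ≤ t) : dist (γ t) (γ s) ≤ t - s := by
  have h1 := eVariationOn.edist_le γ (s := I ∩ Icc s t) (x := t) (y := s)
    ⟨ht, right_mem_Icc.2 hst⟩ ⟨hs, left_mem_Icc.2 hst⟩
  rw [hγ hs ht, NNReal.coe_one, one_mul, edist_dist] at h1
  exact (ENNReal.ofReal_le_ofReal_iff (sub_nonneg.2 hst)).1 h1

theorem continuousOn_of_hasUnitSpeedOn {γ : ℝ → X} {I : Set ℝ} (hγ : HasUnitSpeedOn γ I) :
    ContinuousOn γ I := by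
  refine (LipschitzOnWith.of_dist_le_mul (K := 1) ?_).continuousOn
  intro x hx y hy
  rw [Real.dist_eq, NNReal.coe_one, one_mul]
  rcases le_total x y with h | h
  · rw [dist_comm, abs_sub_comm, abs_of_nonneg (sub_nonneg.2 h)]
    exact dist_le_of_hasUnitSpeedOn hγ hx hy h
  · rw [abs_of_nonneg (sub_nonneg.2 h)]
    exact dist_le_of_hasUnitSpeedOn hγ hy hx h

theorem hasUnitSpeedOn_shift {γ : ℝ → X} {L s t : ℝ} (hγ : HasUnitSpeedOn γ (Icc 0 L))
    (hs : 0 ≤ s) (ht : t ≤ L) : HasUnitSpeedOn (fun x => γ (s + x)) (Icc 0 (t - s)) := by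
  intro x hx y hy
  have hm : MonotoneOn (fun x : ℝ => s + x) (Icc 0 (t - s) ∩ Icc x y) :=
    fun a _ b _ hab => by simpa using hab
  have him : (fun x : ℝ => s + x) '' (Icc 0 (t - s) ∩ Icc x y) =
      Icc 0 L ∩ Icc (s + x) (s + y) := by
    have e1 : Icc 0 (t - s) ∩ Icc x y = Icc x y :=
      inter_eq_right.2 (Icc_subset_Icc hx.1 hy.2)
    have e2 : Icc 0 L ∩ Icc (s + x) (s + y) = Icc (s + x) (s + y) :=
      inter_eq_right.2 (Icc_subset_Icc (by linarith [hx.1]) (by linarith [hy.2]))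
    rw [e1, e2, image_const_add_Icc]
  have := eVariationOn.comp_eq_of_monotoneOn γ (fun x : ℝ => s + x) hm
  rw [him, hγ ⟨by linarith [hx.1], by linarith [hx.2]⟩ ⟨by linarith [hy.1], by linarith [hy.2]⟩]
    at this
  rw [show y - x = s + y - (s + x) by ring]
  exact this

variable [MeasurableSpace X]

/-- The upper gradient inequality on subarcs. -/
theorem IsUpperGradient.le_lintegral_Ioc {f : X → ℝ} {g : X → ℝ≥0∞} (hg : IsUpperGradient f g)
    {γ : ℝ → X} {L s t : ℝ} (hγ : HasUnitSpeedOn γ (Icc 0 L)) (hs : 0 ≤ s) (hst : s ≤ t)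
    (ht : t ≤ L) : ENNReal.ofReal |f (γ t) - f (γ s)| ≤ ∫⁻ x in Ioc s t, g (γ x) := by
  rcases hst.eq_or_lt with rfl | hlt
  · simp
  have h1 := hg.2 (t - s) (fun x => γ (s + x)) (sub_pos.2 hlt) (hasUnitSpeedOn_shift hγ hs ht)
  simp only [add_sub_cancel, add_zero] at h1
  refine h1.trans (le_of_eq ?_)
  have h2 := (measurePreserving_add_left (volume : Measure ℝ) s).setLIntegral_comp_preimage_emb
    (measurableEmbedding_addLeft s) (fun x => g (γ x)) (Icc s t)
  rw [setLIntegral_congr Ioc_ae_eq_Icc, ← h2]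
  congr 2
  ext x
  simp only [mem_Icc, mem_preimage]
  constructor <;> rintro ⟨h, h'⟩ <;> constructor <;> linarith

/-- Along a curve with finite `∫_γ g ds` the function `f` is continuous. -/
theorem IsUpperGradient.continuousOn_comp {f : X → ℝ} {g : X → ℝ≥0∞} (hg : IsUpperGradient f g)
    {γ : ℝ → X} {L : ℝ} (hγ : HasUnitSpeedOn γ (Icc 0 L))
    (hfin : ∫⁻ x in Icc 0 L, g (γ x) ≠ ∞) : ContinuousOn (fun t => f (γ t)) (Icc 0 L) := by
  rw [Metric.continuousOn_iff]
  intro b hb ε hε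
  obtain ⟨δ, hδ, hδε⟩ := exists_pos_setLIntegral_lt_of_measure_lt hfin
    (ε := ENNReal.ofReal ε) (by simpa using hε)
  have key : ∀ s t, 0 ≤ s → s ≤ t → t ≤ L → ENNReal.ofReal (t - s) < δ →
      |f (γ t) - f (γ s)| < ε := by
    intro s t hs hst ht hlt
    have h1 := hδε (Ioc s t) (by
      refine (Measure.le_iff'.1 Measure.restrict_le_self _).trans_lt ?_
      rwa [Real.volume_Ioc])
    rw [Measure.restrict_restrict measurableSet_Ioc,
      inter_eq_left.2 (Ioc_subset_Icc_self.trans (Icc_subset_Icc hs ht))] at h1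
    exact (ENNReal.ofReal_lt_ofReal_iff hε).1 ((hg.le_lintegral_Ioc hγ hs hst ht).trans_lt h1)
  obtain ⟨η, hη, hηδ⟩ : ∃ η : ℝ, 0 < η ∧ ENNReal.ofReal η ≤ δ := by
    rcases eq_or_ne δ ∞ with rfl | h
    · exact ⟨1, one_pos, le_top⟩
    · exact ⟨δ.toReal, ENNReal.toReal_pos hδ.ne' h, ENNReal.ofReal_toReal_le⟩
  refine ⟨η, hη, fun a ha hab => ?_⟩
  rw [Real.dist_eq] at hab ⊢
  rcases le_total a b with h | h
  · rw [abs_sub_comm]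
    rw [abs_sub_comm, abs_of_nonneg (sub_nonneg.2 h)] at hab
    exact key a b ha.1 h hb.2 (((ENNReal.ofReal_lt_ofReal_iff hη).2 hab).trans_le hηδ)
  · rw [abs_of_nonneg (sub_nonneg.2 h)] at hab
    exact key b a hb.1 h ha.2 (((ENNReal.ofReal_lt_ofReal_iff hη).2 hab).trans_le hηδ)

/-- If `g` is an upper gradient of `f` and `w ≥ 0` is `1`-Lipschitz, the truncation of `f` to
`[-w, w]` has the upper gradient `g + 1_A` for any Borel set `A` containing all points of
`{w > 0}` at which the truncation is active. No gradient is needed on `{w = 0}`. -/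
theorem IsUpperGradient.clamp [BorelSpace X] {f w : X → ℝ} {g : X → ℝ≥0∞}
    (hg : IsUpperGradient f g) (hw0 : ∀ x, 0 ≤ w x) (hw : ∀ x y, |w x - w y| ≤ dist x y)
    {A : Set X} (hA : MeasurableSet A) (hfA : ∀ x, 0 < w x → w x ≤ |f x| → x ∈ A) :
    IsUpperGradient (fun x => clamp (w x) (f x)) (fun x => g x + A.indicator 1 x) := by
  refine ⟨hg.1.add (measurable_one.indicator hA), fun L γ hL hγ => ?_⟩
  by_cases hfin : ∫⁻ x in Icc 0 L, g (γ x) = ∞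
  · refine le_top.trans ?_
    rw [← hfin]
    exact lintegral_mono fun x => le_self_add
  have h1 := ofReal_abs_clamp_sub_clamp_le (F := fun t => f (γ t)) (W := fun t => w (γ t))
    (G := fun t => g (γ t)) hL.le (hg.continuousOn_comp hγ hfin) (fun t => hw0 _)
    (fun s t hs hst ht => hg.le_lintegral_Ioc hγ hs hst ht)
    (fun s t hs hst ht => (hw _ _).trans (dist_le_of_hasUnitSpeedOn hγ
      ⟨hs, hst.trans ht⟩ ⟨hs.trans hst, ht⟩ hst))
  refine h1.trans ?_
  have hc : Continuous (fun t => γ (projIcc 0 L hL.le t)) :=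
    (continuousOn_iff_continuous_domRestrict.1 (continuousOn_of_hasUnitSpeedOn hγ)).comp
      continuous_projIcc
  set T : Set ℝ := (fun t => γ (projIcc 0 L hL.le t)) ⁻¹' A with hT
  have hTm : MeasurableSet T := hc.measurable hA
  have hTA : ∀ t ∈ Icc 0 L, (t ∈ T ↔ γ t ∈ A) := fun t ht => by
    simp only [hT, mem_preimage]
    rw [projIcc_of_mem hL.le ht]
  have e : ∫⁻ t in Icc 0 L, (g (γ t) + A.indicator (1 : X → ℝ≥0∞) (γ t)) =
      (∫⁻ t in Icc 0 L, g (γ t)) + volume (T ∩ Icc 0 L) := by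
    rw [← Measure.restrict_apply hTm, ← lintegral_indicator_one hTm,
      ← lintegral_add_right _ (measurable_one.indicator hTm)]
    refine setLIntegral_congr_fun measurableSet_Icc fun t ht => ?_
    congr 1
    by_cases h : t ∈ T
    · simp [h, (hTA t ht).1 h]
    · simp [h, mt (hTA t ht).2 h]
  rw [e]
  refine add_le_add le_rfl (measure_mono fun t ht => ⟨(hTA t ht.1).2 (hfA _ ht.2.1 ht.2.2), ht.1⟩)

theorem IsUpperGradient.add {u v : X → ℝ} {g h : X → ℝ≥0∞} (hu : IsUpperGradient u g)
    (hv : IsUpperGradient v h) : IsUpperGradient (u + v) (g + h) := by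
  refine ⟨hu.1.add hv.1, fun L γ hL hγ => ?_⟩
  calc ENNReal.ofReal |(u + v) (γ L) - (u + v) (γ 0)|
      ≤ ENNReal.ofReal (|u (γ L) - u (γ 0)| + |v (γ L) - v (γ 0)|) := by
        apply ENNReal.ofReal_le_ofReal
        simp only [Pi.add_apply]
        rw [add_sub_add_comm]
        exact abs_add_le _ _
    _ = ENNReal.ofReal |u (γ L) - u (γ 0)| + ENNReal.ofReal |v (γ L) - v (γ 0)| :=
        ENNReal.ofReal_add (abs_nonneg _) (abs_nonneg _)
    _ ≤ (∫⁻ t in Icc 0 L, g (γ t)) + ∫⁻ t in Icc 0 L, h (γ t) :=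
        add_le_add (hu.2 L γ hL hγ) (hv.2 L γ hL hγ)
    _ ≤ ∫⁻ t in Icc 0 L, (g + h) (γ t) := le_lintegral_add _ _

theorem IsUpperGradient.neg {u : X → ℝ} {g : X → ℝ≥0∞} (hu : IsUpperGradient u g) :
    IsUpperGradient (-u) g := by
  refine ⟨hu.1, fun L γ hL hγ => ?_⟩
  refine le_trans (le_of_eq ?_) (hu.2 L γ hL hγ)
  simp only [Pi.neg_apply]
  rw [← abs_neg]
  ring_nf

end UpperGradient

/-! ### Doubling measures and separated sets -/

section Doubling

variable {X : Type*} [MetricSpace X] [MeasurableSpace X] {μ : Measure X} {C : ℝ≥0}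

theorem measure_ball_two_pow_mul_le
    (hC : ∀ (x : X) (r : ℝ), 0 < r → μ (ball x (2 * r)) ≤ C * μ (ball x r))
    (x : X) {r : ℝ} (hr : 0 < r) (n : ℕ) :
    μ (ball x (2 ^ n * r)) ≤ (C : ℝ≥0∞) ^ n * μ (ball x r) := by
  induction n with
  | zero => simp
  | succ n ih =>
    calc μ (ball x (2 ^ (n + 1) * r)) = μ (ball x (2 * (2 ^ n * r))) := by
          rw [pow_succ]; ring_nf
      _ ≤ C * μ (ball x (2 ^ n * r)) := hC _ _ (by positivity)
      _ ≤ C * (C ^ n * μ (ball x r)) := by gcongr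
      _ = C ^ (n + 1) * μ (ball x r) := by rw [pow_succ]; ring

theorem measure_ball_lt_top [IsLocallyFiniteMeasure μ] (h : IsDoubling μ) (x : X) (r : ℝ) :
    μ (ball x r) < ∞ := by
  obtain ⟨C, hC⟩ := h
  obtain ⟨ε, hε, hfin⟩ := (μ.finiteAt_nhds x).exists_mem_basis Metric.nhds_basis_ball
  obtain ⟨n, hn⟩ := pow_unbounded_of_one_lt (r / ε) one_lt_two
  have hr : r ≤ 2 ^ n * ε := ((div_lt_iff₀ hε).1 hn).le
  calc μ (ball x r) ≤ μ (ball x (2 ^ n * ε)) := measure_mono (ball_subset_ball hr)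
    _ ≤ (C : ℝ≥0∞) ^ n * μ (ball x ε) := measure_ball_two_pow_mul_le hC x hε n
    _ < ∞ := ENNReal.mul_lt_top (ENNReal.pow_lt_top ENNReal.coe_lt_top) hfin

/-- In a doubling space the number of `r`-separated points in a ball of radius `5r` is bounded by
a power of the doubling constant. -/
theorem card_le_of_separated [OpensMeasurableSpace X] [IsLocallyFiniteMeasure μ]
    [μ.IsOpenPosMeasure]
    (hC : ∀ (x : X) (r : ℝ), 0 < r → μ (ball x (2 * r)) ≤ C * μ (ball x r))
    {r : ℝ} (hr : 0 < r) (z : X) (F : Finset X)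
    (hsep : ∀ x ∈ F, ∀ y ∈ F, x ≠ y → r ≤ dist x y) (hF : ∀ x ∈ F, dist x z < 5 * r) :
    (F.card : ℝ≥0∞) ≤ (C : ℝ≥0∞) ^ 5 := by
  have hpos : μ (ball z (6 * r)) ≠ 0 := (measure_ball_pos μ z (by positivity)).ne'
  have hfin : μ (ball z (6 * r)) ≠ ∞ := (measure_ball_lt_top ⟨C, hC⟩ z _).ne
  refine (ENNReal.mul_le_mul_iff_left hpos hfin).1 ?_
  calc (F.card : ℝ≥0∞) * μ (ball z (6 * r)) = ∑ x ∈ F, μ (ball z (6 * r)) := by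
        rw [Finset.sum_const, nsmul_eq_mul]
    _ ≤ ∑ x ∈ F, (C : ℝ≥0∞) ^ 5 * μ (ball x (r / 2)) := by
        -- `B(z, 6r) ⊆ B(x, 11r) ⊆ B(x, 2⁵ · r/2)`
        refine Finset.sum_le_sum fun x hx => ?_
        refine (measure_mono (ball_subset_ball' ?_)).trans
          (measure_ball_two_pow_mul_le hC x (half_pos hr) 5)
        have := hF x hx
        rw [dist_comm] at this
        linarith
    _ = (C : ℝ≥0∞) ^ 5 * μ (⋃ x ∈ F, ball x (r / 2)) := by
        rw [← Finset.mul_sum, measure_biUnion_finset _ fun x _ => measurableSet_ball]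
        intro x hx y hy hxy
        exact ball_disjoint_ball (by linarith [hsep x hx y hy hxy])
    _ ≤ (C : ℝ≥0∞) ^ 5 * μ (ball z (6 * r)) := by
        gcongr
        refine iUnion₂_subset fun x hx => ball_subset_ball' ?_
        linarith [hF x hx]

end Doubling

/-! ### The discrete energy is dominated by the upper gradient energy -/

section Energy

theorem tsum_const_le_of_card_le {ι : Type*} {N : ℝ≥0∞} (c : ℝ≥0∞)
    (h : ∀ F : Finset ι, (F.card : ℝ≥0∞) ≤ N) : ∑' _ : ι, c ≤ N * c := by
  rw [ENNReal.tsum_eq_iSup_sum]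
  refine iSup_le fun F => ?_
  rw [Finset.sum_const, nsmul_eq_mul]
  gcongr
  exact h F

/-- Integrals of a function over a family of sets with overlap at most `N` add up to at most `N`
times its integral. -/
theorem tsum_setLIntegral_le_of_overlap {X ι : Type*} [MeasurableSpace X] {μ : Measure X} {N : ℝ≥0∞} {B : ι → Set X}
    (hB : ∀ i, MeasurableSet (B i)) {G : X → ℝ≥0∞} (hG : Measurable G)
    (h : ∀ z, ∀ F : Finset ι, (∀ i ∈ F, z ∈ B i) → (F.card : ℝ≥0∞) ≤ N) :
    ∑' i, ∫⁻ z in B i, G z ∂μ ≤ N * ∫⁻ z, G z ∂μ := by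
  classical
  rw [ENNReal.tsum_eq_iSup_sum]
  refine iSup_le fun F => ?_
  calc ∑ i ∈ F, ∫⁻ z in B i, G z ∂μ = ∫⁻ z, ∑ i ∈ F, (B i).indicator G z ∂μ := by
        rw [lintegral_finsetSum F fun i _ => hG.indicator (hB i)]
        exact Finset.sum_congr rfl fun i _ => (lintegral_indicator (hB i) G).symm
    _ ≤ ∫⁻ z, N * G z ∂μ := by
        refine lintegral_mono fun z => ?_
        simp only [indicator_apply]
        rw [← Finset.sum_filter, Finset.sum_const, nsmul_eq_mul]
        gcongr
        exact h z _ fun i hi => (Finset.mem_filter.1 hi).2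
    _ = N * ∫⁻ z, G z ∂μ := lintegral_const_mul _ hG

variable {X : Type*} [MetricSpace X] [MeasurableSpace X] {μ : Measure X}

theorem ofReal_abs_setAverage_sub_le {X : Type*} [MeasurableSpace X] {μ : Measure X} {f : X → ℝ} {s : Set X} (hs0 : μ s ≠ 0) (hs : μ s ≠ ∞)
    (hf : IntegrableOn f s μ) (m : ℝ) :
    ENNReal.ofReal |(⨍ z in s, f z ∂μ) - m| ≤
      (μ s)⁻¹ * ∫⁻ z in s, ENNReal.ofReal |f z - m| ∂μ := by
  have e : (⨍ z in s, f z ∂μ) - m = (μ.real s)⁻¹ * ∫ z in s, (f z - m) ∂μ := by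
    have hμ : μ.real s ≠ 0 := ENNReal.toReal_ne_zero.2 ⟨hs0, hs⟩
    rw [integral_sub hf (integrableOn_const hs), setAverage_eq, setIntegral_const, smul_eq_mul,
      smul_eq_mul]
    field_simp
  rw [e, abs_mul, ENNReal.ofReal_mul (abs_nonneg _), abs_of_nonneg (by positivity)]
  gcongr
  · rw [Measure.real, ENNReal.ofReal_inv_of_pos (ENNReal.toReal_pos hs0 hs),
      ENNReal.ofReal_toReal hs]
  · have h := enorm_integral_le_lintegral_enorm (μ := μ.restrict s) (fun z => f z - m)
    simpa only [Real.enorm_eq_ofReal_abs] using h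

/-- The square of the Poincaré inequality, applied to two balls of radius `r/4` inside
`B(x, 5r)`: a single term of the discrete energy is controlled by `∫ g²` over `B(x, 5r)`. -/
theorem energy_term_le [OpensMeasurableSpace X] [IsLocallyFiniteMeasure μ]
    [μ.IsOpenPosMeasure] {C P : ℝ≥0}
    (hC : ∀ (x : X) (r : ℝ), 0 < r → μ (ball x (2 * r)) ≤ C * μ (ball x r))
    {f : X → ℝ} {g : X → ℝ≥0∞} (hf : ∀ (x : X) (r : ℝ), IntegrableOn f (ball x r) μ)
    (hP : ∀ (x : X) (r : ℝ), 0 < r →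
      ⨍⁻ y in ball x r, ENNReal.ofReal |f y - ⨍ z in ball x r, f z ∂μ| ∂μ ≤
        P * ENNReal.ofReal r * (⨍⁻ y in ball x r, g y ^ 2 ∂μ) ^ (1 / 2 : ℝ))
    {r : ℝ} (hr : 0 < r) {x y : X} (hxy : dist x y < 4 * r) :
    ENNReal.ofReal (|discretize μ r f y - discretize μ r f x| ^ 2 / r ^ 2) * μ (ball x (2 * r)) ≤
      ((10 * C ^ 6 * P : ℝ≥0) : ℝ≥0∞) ^ 2 * ∫⁻ z in ball x (5 * r), g z ^ 2 ∂μ := by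
  set B := ball x (5 * r) with hB
  have hB0 : μ B ≠ 0 := (measure_ball_pos μ x (by positivity)).ne'
  have hBt : μ B ≠ ∞ := (measure_ball_lt_top ⟨C, hC⟩ x _).ne
  set m := ⨍ z in B, f z ∂μ with hm
  set I := ∫⁻ z in B, g z ^ 2 ∂μ with hI
  set D := (P : ℝ≥0∞) * ENNReal.ofReal (5 * r) * (I / μ B) ^ (1 / 2 : ℝ) with hD
  have hPB : (∫⁻ z in B, ENNReal.ofReal |f z - m| ∂μ) / μ B ≤ D := by
    have := hP x (5 * r) (by positivity)
    rwa [setLAverage_eq, setLAverage_eq] at this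
  have hone : ∀ p, dist x p < 4 * r →
      ENNReal.ofReal |discretize μ r f p - m| ≤ (C : ℝ≥0∞) ^ 6 * D := by
    intro p hp
    have hb0 : μ (ball p (r / 4)) ≠ 0 := (measure_ball_pos μ p (by positivity)).ne'
    have hbt : μ (ball p (r / 4)) ≠ ∞ := (measure_ball_lt_top ⟨C, hC⟩ p _).ne
    have hsub : ball p (r / 4) ⊆ B := ball_subset_ball' (by rw [dist_comm]; linarith)
    -- `B(x, 5r) ⊆ B(p, 9r) ⊆ B(p, 2⁶ · r/4)`
    have hBp : μ B ≤ (C : ℝ≥0∞) ^ 6 * μ (ball p (r / 4)) :=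
      (measure_mono (ball_subset_ball' (by linarith))).trans
        (measure_ball_two_pow_mul_le hC p (by positivity : 0 < r / 4) 6)
    calc ENNReal.ofReal |discretize μ r f p - m|
        ≤ (μ (ball p (r / 4)))⁻¹ * ∫⁻ z in ball p (r / 4), ENNReal.ofReal |f z - m| ∂μ :=
          ofReal_abs_setAverage_sub_le hb0 hbt (hf _ _) m
      _ ≤ (μ (ball p (r / 4)))⁻¹ * ∫⁻ z in B, ENNReal.ofReal |f z - m| ∂μ := by
          gcongr
      _ = (μ (ball p (r / 4)))⁻¹ * (μ B * ((∫⁻ z in B, ENNReal.ofReal |f z - m| ∂μ) / μ B)) := by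
          rw [ENNReal.mul_div_cancel hB0 hBt]
      _ ≤ (μ (ball p (r / 4)))⁻¹ * (((C : ℝ≥0∞) ^ 6 * μ (ball p (r / 4))) * D) := by
          gcongr
      _ = (μ (ball p (r / 4)) * (μ (ball p (r / 4)))⁻¹) * ((C : ℝ≥0∞) ^ 6 * D) := by ring
      _ = (C : ℝ≥0∞) ^ 6 * D := by rw [ENNReal.mul_inv_cancel hb0 hbt, one_mul]
  set d := discretize μ r f y - discretize μ r f x with hd
  have hdiff : ENNReal.ofReal |d| ≤ 2 * ((C : ℝ≥0∞) ^ 6 * D) := by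
    calc ENNReal.ofReal |d|
        ≤ ENNReal.ofReal (|discretize μ r f y - m| + |discretize μ r f x - m|) := by
          apply ENNReal.ofReal_le_ofReal
          rw [hd, abs_sub_comm (discretize μ r f x)]
          exact abs_sub_le _ _ _
      _ = ENNReal.ofReal |discretize μ r f y - m| + ENNReal.ofReal |discretize μ r f x - m| :=
          ENNReal.ofReal_add (abs_nonneg _) (abs_nonneg _)
      _ ≤ _ := by
          rw [two_mul]
          exact add_le_add (hone y hxy) (hone x (by simpa using hr))
  have hroot : ((I / μ B) ^ (1 / 2 : ℝ)) ^ 2 = I / μ B := by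
    rw [← ENNReal.rpow_natCast, ← ENNReal.rpow_mul]
    norm_num
  have hr2 : (ENNReal.ofReal r)⁻¹ * ENNReal.ofReal r = 1 :=
    ENNReal.inv_mul_cancel (by simpa using hr) ENNReal.ofReal_ne_top
  have e5 : ENNReal.ofReal (5 * r) = 5 * ENNReal.ofReal r := by
    rw [ENNReal.ofReal_mul (by norm_num)]
    norm_num
  calc ENNReal.ofReal (|d| ^ 2 / r ^ 2) * μ (ball x (2 * r))
      = (ENNReal.ofReal |d| * (ENNReal.ofReal r)⁻¹) ^ 2 * μ (ball x (2 * r)) := by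
        rw [← div_pow, ENNReal.ofReal_pow (by positivity), ENNReal.ofReal_div_of_pos hr,
          div_eq_mul_inv]
    _ ≤ (2 * ((C : ℝ≥0∞) ^ 6 * D) * (ENNReal.ofReal r)⁻¹) ^ 2 * μ B := by
        gcongr
        exact ball_subset_ball (by linarith)
    _ = (10 * (C : ℝ≥0∞) ^ 6 * P) ^ 2 * ((ENNReal.ofReal r)⁻¹ * ENNReal.ofReal r) ^ 2 *
          (((I / μ B) ^ (1 / 2 : ℝ)) ^ 2 * μ B) := by
        rw [hD, e5]
        ring
    _ = (10 * (C : ℝ≥0∞) ^ 6 * P) ^ 2 * I := by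
        rw [hr2, hroot, one_pow, mul_one, ENNReal.div_mul_cancel hB0 hBt]
    _ = _ := by push_cast; rfl

theorem integrableOn_ball_of_memLp [IsLocallyFiniteMeasure μ] (hd : IsDoubling μ) {f : X → ℝ}
    (hf : MemLp f 2 μ) (x : X) (r : ℝ) : IntegrableOn f (ball x r) μ := by
  have : IsFiniteMeasure (μ.restrict (ball x r)) :=
    ⟨by rw [Measure.restrict_apply_univ]; exact measure_ball_lt_top hd x r⟩
  exact (hf.restrict _).integrable (by norm_num)

/-- The discrete energies are bounded by the upper gradient energy, uniformly in the scale. -/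
theorem exists_netEnergy_le [OpensMeasurableSpace X] [IsLocallyFiniteMeasure μ]
    [μ.IsOpenPosMeasure] (hdoub : IsDoubling μ) (hpoin : SupportsPoincare μ) :
    ∃ K : ℝ≥0, ∀ (r : ℝ), 0 < r → ∀ A : Set X, IsNet r A → ∀ f : X → ℝ, MemLp f 2 μ →
      netEnergy μ r A f ≤ K * upperEnergy μ f := by
  obtain ⟨C, hC⟩ := hdoub
  obtain ⟨P, hP⟩ := hpoin
  set M : ℝ≥0 := (10 * C ^ 6 * P) ^ 2 with hM
  refine ⟨C ^ 5 * (C ^ 5 * M), fun r hr A hA f hf => ?_⟩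
  have hint := integrableOn_ball_of_memLp ⟨C, hC⟩ hf
  have hcard : ∀ (z : X) (F : Finset A), (∀ i ∈ F, dist (i : X) z < 5 * r) →
      (F.card : ℝ≥0∞) ≤ (C : ℝ≥0∞) ^ 5 := by
    intro z F hF
    rw [← Finset.card_map (Function.Embedding.subtype (· ∈ A))]
    refine card_le_of_separated hC hr z _ ?_ ?_
    · intro x hx y hy hxy
      obtain ⟨x, -, rfl⟩ := Finset.mem_map.1 hx
      obtain ⟨y, -, rfl⟩ := Finset.mem_map.1 hy
      exact hA.1 _ x.2 _ y.2 hxy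
    · intro x hx
      obtain ⟨x, hx', rfl⟩ := Finset.mem_map.1 hx
      exact hF x hx'
  have hadj : ∀ x y : A, (netGraph r A).Adj x y → dist (x : X) y < 4 * r := by
    rintro x y ⟨-, z, hzx, hzy⟩
    have := dist_triangle_left (x : X) y z
    rw [mem_ball] at hzx hzy
    linarith
  have key : ∀ g, IsUpperGradient f g →
      netEnergy μ r A f ≤ ((C ^ 5 * (C ^ 5 * M) : ℝ≥0) : ℝ≥0∞) * ∫⁻ z, g z ^ 2 ∂μ := by
    intro g hg
    calc netEnergy μ r A f
        ≤ ∑' x : A, ∑' _ : (netGraph r A).neighborSet x,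
            (M : ℝ≥0∞) * ∫⁻ z in ball (x : X) (5 * r), g z ^ 2 ∂μ := by
          refine ENNReal.tsum_le_tsum fun x => ENNReal.tsum_le_tsum fun y => ?_
          have := energy_term_le hC hint (fun x r hr => hP f g hint hg x r hr) hr
            (hadj x y y.2)
          rwa [← ENNReal.coe_pow] at this
      _ ≤ ∑' x : A, (C : ℝ≥0∞) ^ 5 * (M * ∫⁻ z in ball (x : X) (5 * r), g z ^ 2 ∂μ) := by
          refine ENNReal.tsum_le_tsum fun x => tsum_const_le_of_card_le _ fun F => ?_
          rw [← Finset.card_map (Function.Embedding.subtype (· ∈ (netGraph r A).neighborSet x))]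
          refine hcard x _ fun i hi => ?_
          obtain ⟨i, -, rfl⟩ := Finset.mem_map.1 hi
          have := hadj x i i.2
          rw [dist_comm] at this
          simp only [Function.Embedding.subtype_apply]
          linarith
      _ = (C : ℝ≥0∞) ^ 5 * (M * ∑' x : A, ∫⁻ z in ball (x : X) (5 * r), g z ^ 2 ∂μ) := by
          rw [ENNReal.tsum_mul_left, ENNReal.tsum_mul_left]
      _ ≤ (C : ℝ≥0∞) ^ 5 * (M * ((C : ℝ≥0∞) ^ 5 * ∫⁻ z, g z ^ 2 ∂μ)) := by
          gcongr
          refine tsum_setLIntegral_le_of_overlap (fun x => measurableSet_ball)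
            (hg.1.pow_const 2) fun z F hF => hcard z F fun i hi => ?_
          rw [dist_comm]
          exact hF i hi
      _ = _ := by push_cast; ring
  -- `K = 0` is possible, so moving `K` into the infimum needs some upper gradient to exist.
  have htop : IsUpperGradient f (fun _ => ∞) := by
    refine ⟨measurable_const, fun L γ hL _ => le_top.trans_eq ?_⟩
    rw [lintegral_const, Measure.restrict_apply_univ, Real.volume_Icc, ENNReal.top_mul]
    simpa using hL
  have : Nonempty {g // IsUpperGradient f g} := ⟨⟨_, htop⟩⟩
  rw [upperEnergy, iInf_subtype', ENNReal.mul_iInf fun h => absurd h ENNReal.coe_ne_top]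
  exact le_iInf fun g => key g g.2

/-- Minkowski's inequality for `√𝓔_r`. -/
theorem sqrt_netEnergy_le_add {r : ℝ} (A : Set X) {f h : X → ℝ}
    (hf : ∀ x : X, IntegrableOn f (ball x (r / 4)) μ)
    (hh : ∀ x : X, IntegrableOn h (ball x (r / 4)) μ) :
    netEnergy μ r A (f + h) ^ (1 / 2 : ℝ) ≤
      netEnergy μ r A f ^ (1 / 2 : ℝ) + netEnergy μ r A h ^ (1 / 2 : ℝ) := by
  let ι := Σ x : A, (netGraph r A).neighborSet x
  let _ : MeasurableSpace ι := ⊤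
  have : MeasurableSingletonClass ι := ⟨fun _ => trivial⟩
  -- The energy is the square of the `ℓ²` norm of `a u`.
  let a : (X → ℝ) → ι → ℝ≥0∞ := fun u p =>
    ENNReal.ofReal (|discretize μ r u (p.2 : A) - discretize μ r u p.1| / |r|) *
      μ (ball (p.1 : X) (2 * r)) ^ (1 / 2 : ℝ)
  have ha : ∀ u, netEnergy μ r A u = ∫⁻ p, a u p ^ (2 : ℝ) ∂Measure.count := by
    intro u
    rw [lintegral_count, ENNReal.tsum_sigma', netEnergy]
    refine tsum_congr fun x => tsum_congr fun y => ?_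
    simp only [a]
    rw [ENNReal.mul_rpow_of_nonneg _ _ zero_le_two, ← ENNReal.rpow_mul,
      ENNReal.ofReal_rpow_of_nonneg (by positivity) zero_le_two]
    norm_num [div_pow]
  have hadd : ∀ x : X, discretize μ r (f + h) x = discretize μ r f x + discretize μ r h x := by
    intro x
    simp only [discretize, setAverage_eq, Pi.add_apply, smul_eq_mul]
    rw [integral_add (hf x) (hh x), mul_add]
  have hle : ∀ p, a (f + h) p ≤ (a f + a h) p := by
    intro p
    simp only [a, Pi.add_apply]
    rw [← add_mul, ← ENNReal.ofReal_add (by positivity) (by positivity), ← add_div]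
    gcongr
    rw [hadd, hadd, add_sub_add_comm]
    exact abs_add_le _ _
  rw [ha, ha, ha]
  refine le_trans ?_ (ENNReal.lintegral_Lp_add_le (measurable_from_top.aemeasurable)
    (measurable_from_top.aemeasurable) one_le_two)
  gcongr with p
  exact hle p

end Energy

/-! ### Convergence in the Newton-Sobolev norm -/

section Convergence

theorem continuous_of_abs_sub_le_dist {X : Type*} [MetricSpace X] {w : X → ℝ}
    (hw : ∀ x y, |w x - w y| ≤ dist x y) : Continuous w :=
  (LipschitzWith.of_dist_le_mul (K := 1) fun x y => by
    simpa [Real.dist_eq] using hw x y).continuous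

variable {X : Type*} [MetricSpace X] [MeasurableSpace X] {μ : Measure X}

theorem tendsto_N12norm_zero_iff {f : ℕ → X → ℝ} :
    Tendsto (fun j => N12norm μ (f j)) atTop (𝓝 0) ↔
      Tendsto (fun j => ∫⁻ x, ENNReal.ofReal (|f j x| ^ 2) ∂μ) atTop (𝓝 0) ∧
        Tendsto (fun j => upperEnergy μ (f j)) atTop (𝓝 0) := by
  constructor
  · intro h
    have h2 : Tendsto (fun j => (∫⁻ x, ENNReal.ofReal (|f j x| ^ 2) ∂μ) + upperEnergy μ (f j))
        atTop (𝓝 0) := by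
      have := h.ennrpow_const 2
      simp only [N12norm, ← ENNReal.rpow_mul] at this
      norm_num only [ENNReal.rpow_one, ENNReal.zero_rpow_of_pos] at this
      exact this
    exact ⟨tendsto_of_tendsto_of_tendsto_of_le_of_le tendsto_const_nhds h2
        (fun _ => zero_le) fun _ => le_self_add,
      tendsto_of_tendsto_of_tendsto_of_le_of_le tendsto_const_nhds h2
        (fun _ => zero_le) fun _ => le_add_self⟩
  · rintro ⟨h1, h2⟩
    have := (h1.add h2).ennrpow_const (1 / 2)
    simpa [N12norm] using this

theorem lintegral_add_sq_le {X : Type*} [MeasurableSpace X] {μ : Measure X} {g h : X → ℝ≥0∞} (hg : Measurable g) (hh : Measurable h) :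
    ∫⁻ x, (g x + h x) ^ 2 ∂μ ≤ 2 * (∫⁻ x, g x ^ 2 ∂μ) + 2 * ∫⁻ x, h x ^ 2 ∂μ := by
  rw [← mul_add, ← lintegral_add_left (hg.pow_const 2),
    ← lintegral_const_mul 2 (f := fun x => g x ^ 2 + h x ^ 2)
      ((hg.pow_const 2).add (hh.pow_const 2))]
  refine lintegral_mono fun x => ?_
  have := ENNReal.rpow_add_le_mul_rpow_add_rpow (g x) (h x) one_le_two
  norm_num at this
  exact this

theorem neg_mem_N12 {u : X → ℝ} (hu : u ∈ N12 μ) : -u ∈ N12 μ := by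
  obtain ⟨hu, g, hg, hgi⟩ := hu
  exact ⟨hu.neg, g, hg.neg, hgi⟩

theorem add_mem_N12 {u v : X → ℝ} (hu : u ∈ N12 μ) (hv : v ∈ N12 μ) : u + v ∈ N12 μ := by
  obtain ⟨hu, g, hg, hgi⟩ := hu
  obtain ⟨hv, h, hh, hhi⟩ := hv
  refine ⟨hu.add hv, g + h, hg.add hh, (lintegral_add_sq_le hg.1 hh.1).trans_lt ?_⟩
  exact ENNReal.add_lt_top.2 ⟨ENNReal.mul_lt_top (by simp) hgi, ENNReal.mul_lt_top (by simp) hhi⟩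

theorem sub_mem_N12 {u v : X → ℝ} (hu : u ∈ N12 μ) (hv : v ∈ N12 μ) : u - v ∈ N12 μ := by
  rw [sub_eq_add_neg]
  exact add_mem_N12 hu (neg_mem_N12 hv)

theorem upperEnergy_neg_le (u : X → ℝ) : upperEnergy μ (-u) ≤ upperEnergy μ u :=
  le_iInf₂ fun g hg => iInf₂_le g hg.neg

/-- If `f j → 0` in `L²` and `{w > 0}` has finite measure, the set where truncating `f j` to
`[-w, w]` is active becomes small, although `w` need not be bounded below on `{w > 0}`. -/
theorem tendsto_measure_active_zero [OpensMeasurableSpace X] {f : ℕ → X → ℝ} {w : X → ℝ}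
    (hw : Continuous w) (hμ : μ {x | 0 < w x} ≠ ∞) (hf : ∀ j, AEMeasurable (f j) μ)
    (h0 : Tendsto (fun j => ∫⁻ x, ENNReal.ofReal (|f j x| ^ 2) ∂μ) atTop (𝓝 0)) :
    Tendsto (fun j => μ {x | 0 < w x ∧ w x ≤ |f j x|}) atTop (𝓝 0) := by
  set S : ℕ → Set X := fun n => {x | 0 < w x} ∩ {x | w x ≤ 1 / ((n : ℝ) + 1)} with hS
  have hSlim : Tendsto (μ ∘ S) atTop (𝓝 0) := by
    have hempty : ⋂ n, S n = ∅ := by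
      refine eq_empty_of_forall_notMem fun x hx => ?_
      have hx0 : 0 < w x := (mem_iInter.1 hx 0).1
      obtain ⟨n, hn⟩ := exists_nat_one_div_lt hx0
      exact absurd (mem_iInter.1 hx n).2 (not_le.2 hn)
    have := tendsto_measure_iInter_atTop (μ := μ) (s := S)
      (fun n => ((isOpen_lt continuous_const hw).measurableSet.inter
        (isClosed_le hw continuous_const).measurableSet).nullMeasurableSet)
      (fun m n hmn x hx => ⟨hx.1, (show w x ≤ _ from hx.2).trans (Nat.one_div_le_one_div hmn)⟩)
      ⟨0, ne_top_of_le_ne_top hμ (measure_mono inter_subset_left)⟩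
    rwa [hempty, measure_empty] at this
  rw [ENNReal.tendsto_nhds_zero] at hSlim ⊢
  intro ε hε
  have hε2 : 0 < ε / 2 := ENNReal.half_pos hε.ne'
  obtain ⟨n, hn⟩ := (hSlim (ε / 2) hε2).exists
  set c : ℝ≥0∞ := ENNReal.ofReal ((1 / ((n : ℝ) + 1)) ^ 2) with hc
  have hc0 : c ≠ 0 := by
    rw [hc, Ne, ENNReal.ofReal_eq_zero, not_le]
    positivity
  have hct : c ≠ ∞ := ENNReal.ofReal_ne_top
  have hlim : Tendsto (fun j => (∫⁻ x, ENNReal.ofReal (|f j x| ^ 2) ∂μ) / c) atTop (𝓝 0) := by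
    have := ENNReal.Tendsto.div_const h0 (Or.inr hc0)
    rwa [ENNReal.zero_div] at this
  filter_upwards [ENNReal.tendsto_nhds_zero.1 hlim (ε / 2) hε2] with j hj
  have hsub : {x | 0 < w x ∧ w x ≤ |f j x|} ⊆
      S n ∪ {x | c ≤ ENNReal.ofReal (|f j x| ^ 2)} := by
    rintro x ⟨hx0, hx⟩
    rcases le_or_gt (w x) (1 / ((n : ℝ) + 1)) with h | h
    · exact Or.inl ⟨hx0, h⟩
    · refine Or.inr (ENNReal.ofReal_le_ofReal ?_)
      exact pow_le_pow_left₀ (by positivity) (h.le.trans hx) 2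
  have hmark : μ {x | c ≤ ENNReal.ofReal (|f j x| ^ 2)} ≤ ε / 2 := by
    refine le_trans ?_ hj
    rw [ENNReal.le_div_iff_mul_le (Or.inl hc0) (Or.inl hct), mul_comm]
    refine mul_meas_ge_le_lintegral₀ ?_ c
    exact ((continuous_abs.measurable.comp_aemeasurable (hf j)).pow_const 2).ennreal_ofReal
  calc μ {x | 0 < w x ∧ w x ≤ |f j x|} ≤ μ (S n) + μ {x | c ≤ ENNReal.ofReal (|f j x| ^ 2)} :=
        (measure_mono hsub).trans (measure_union_le _ _)
    _ ≤ ε / 2 + ε / 2 := add_le_add hn hmark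
    _ = ε := ENNReal.add_halves ε

variable [BorelSpace X] {f : X → ℝ} {w : X → ℝ}

/-- The energy estimate for a single upper gradient behind `upperEnergy_clamp_le`. -/
theorem IsUpperGradient.exists_clamp (hw0 : ∀ x, 0 ≤ w x) (hw : ∀ x y, |w x - w y| ≤ dist x y)
    {g : X → ℝ≥0∞} (hg : IsUpperGradient f g) :
    ∃ g', IsUpperGradient (fun x => GraphDirichlet.clamp (w x) (f x)) g' ∧
      ∫⁻ x, g' x ^ 2 ∂μ ≤ 2 * (∫⁻ x, g x ^ 2 ∂μ) + 2 * μ {x | 0 < w x ∧ w x ≤ |f x|} := by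
  -- `f` need not be Borel, so the active set is replaced by a Borel set of the same measure.
  set A := toMeasurable μ {x | 0 < w x ∧ w x ≤ |f x|} with hA
  have hAm : MeasurableSet A := measurableSet_toMeasurable _ _
  refine ⟨_, hg.clamp hw0 hw hAm fun x h0 h1 => subset_toMeasurable _ _ ⟨h0, h1⟩, ?_⟩
  refine (lintegral_add_sq_le hg.1 (measurable_one.indicator hAm)).trans (le_of_eq ?_)
  have e : ∀ x, A.indicator (1 : X → ℝ≥0∞) x ^ 2 = A.indicator 1 x := fun x => by
    by_cases h : x ∈ A <;> simp [h]
  simp only [e]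
  rw [lintegral_indicator_one hAm, hA, measure_toMeasurable]

theorem upperEnergy_clamp_le (hw0 : ∀ x, 0 ≤ w x) (hw : ∀ x y, |w x - w y| ≤ dist x y) :
    upperEnergy μ (fun x => clamp (w x) (f x)) ≤
      2 * upperEnergy μ f + 2 * μ {x | 0 < w x ∧ w x ≤ |f x|} := by
  rw [upperEnergy, upperEnergy, ENNReal.mul_iInf_of_ne two_ne_zero ENNReal.ofNat_ne_top,
    ENNReal.iInf_add]
  refine le_iInf fun g => ?_
  rw [ENNReal.mul_iInf_of_ne two_ne_zero ENNReal.ofNat_ne_top, ENNReal.iInf_add]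
  refine le_iInf fun hg => ?_
  obtain ⟨g', hg', hle⟩ := hg.exists_clamp (μ := μ) hw0 hw
  exact (iInf₂_le g' hg').trans hle

theorem clamp_mem_N12 (hw0 : ∀ x, 0 ≤ w x) (hw : ∀ x y, |w x - w y| ≤ dist x y)
    (hμ : μ {x | 0 < w x} ≠ ∞) (hf : f ∈ N12 μ) : (fun x => clamp (w x) (f x)) ∈ N12 μ := by
  obtain ⟨hf, g, hg, hgi⟩ := hf
  have hwm : AEMeasurable w μ := (continuous_of_abs_sub_le_dist hw).measurable.aemeasurable
  refine ⟨hf.mono ?_ (ae_of_all _ fun x => abs_clamp_le_abs (hw0 x) _), ?_⟩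
  · exact ((hwm.neg.max hf.1.aemeasurable).min hwm).aestronglyMeasurable
  · obtain ⟨g', hg', hle⟩ := hg.exists_clamp (μ := μ) hw0 hw
    refine ⟨g', hg', hle.trans_lt (ENNReal.add_lt_top.2
      ⟨ENNReal.mul_lt_top (by simp) hgi, ENNReal.mul_lt_top (by simp) ?_⟩)⟩
    exact (measure_mono fun x hx => hx.1).trans_lt hμ.lt_top

theorem tendsto_N12norm_clamp (hw0 : ∀ x, 0 ≤ w x) (hw : ∀ x y, |w x - w y| ≤ dist x y)
    (hμ : μ {x | 0 < w x} ≠ ∞) {f : ℕ → X → ℝ} (hf : ∀ j, f j ∈ N12 μ)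
    (h : Tendsto (fun j => N12norm μ (f j)) atTop (𝓝 0)) :
    Tendsto (fun j => N12norm μ (fun x => clamp (w x) (f j x))) atTop (𝓝 0) := by
  rw [tendsto_N12norm_zero_iff] at h ⊢
  constructor
  · refine tendsto_of_tendsto_of_tendsto_of_le_of_le tendsto_const_nhds h.1
      (fun _ => zero_le) fun j => lintegral_mono fun x => ENNReal.ofReal_le_ofReal ?_
    exact pow_le_pow_left₀ (abs_nonneg _) (abs_clamp_le_abs (hw0 x) _) 2
  · have hA := tendsto_measure_active_zero (continuous_of_abs_sub_le_dist hw) hμ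
      (fun j => (hf j).1.1.aemeasurable) h.1
    have hlim := (ENNReal.Tendsto.const_mul h.2 (Or.inr (ENNReal.ofNat_ne_top (n := 2)))).add
      (ENNReal.Tendsto.const_mul hA (Or.inr (ENNReal.ofNat_ne_top (n := 2))))
    rw [mul_zero, add_zero] at hlim
    exact tendsto_of_tendsto_of_tendsto_of_le_of_le tendsto_const_nhds hlim
      (fun _ => zero_le) fun j => upperEnergy_clamp_le hw0 hw

end Convergence

/-! ### Stability of the discrete energies and the truncated sequence -/

section Truncation

theorem tendsto_of_sqrt_le {a b c : ℕ → ℝ≥0∞} {l : ℝ≥0∞} (ha : Tendsto a atTop (𝓝 l))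
    (hc : Tendsto c atTop (𝓝 0))
    (hab : ∀ j, a j ^ (1 / 2 : ℝ) ≤ b j ^ (1 / 2 : ℝ) + c j ^ (1 / 2 : ℝ))
    (hba : ∀ j, b j ^ (1 / 2 : ℝ) ≤ a j ^ (1 / 2 : ℝ) + c j ^ (1 / 2 : ℝ)) :
    Tendsto b atTop (𝓝 l) := by
  have ha' := ha.ennrpow_const (1 / 2)
  have hc' : Tendsto (fun j => c j ^ (1 / 2 : ℝ)) atTop (𝓝 0) := by
    simpa using hc.ennrpow_const (1 / 2)
  have h1 := ENNReal.Tendsto.sub ha' hc' (Or.inr ENNReal.zero_ne_top)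
  have h2 := ha'.add hc'
  rw [tsub_zero] at h1
  rw [add_zero] at h2
  have h3 : Tendsto (fun j => b j ^ (1 / 2 : ℝ)) atTop (𝓝 (l ^ (1 / 2 : ℝ))) :=
    tendsto_of_tendsto_of_tendsto_of_le_of_le h1 h2 (fun j => tsub_le_iff_right.2 (hab j)) hba
  have h4 := h3.ennrpow_const 2
  simp only [← ENNReal.rpow_mul] at h4
  norm_num at h4
  exact h4

variable {X : Type*} [MetricSpace X] [MeasurableSpace X] [BorelSpace X] {μ : Measure X}

/-- Along a sequence converging in `N^{1,2}(X)` the discrete energies have the same limit as those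
of the limit function. -/
theorem tendsto_netEnergy_iff [IsLocallyFiniteMeasure μ] [μ.IsOpenPosMeasure]
    (hdoub : IsDoubling μ) (hpoin : SupportsPoincare μ) {V : ℝ → Set X}
    (hV : ∀ r : ℝ, 0 < r → IsNet r (V r)) {r : ℕ → ℝ} (hr : ∀ k, 0 < r k)
    {v : ℕ → X → ℝ} {u : X → ℝ} (hv : TendstoN12 μ v u) (l : ℝ≥0∞) :
    Tendsto (fun j => netEnergy μ (r j) (V (r j)) (v j)) atTop (𝓝 l) ↔
      Tendsto (fun j => netEnergy μ (r j) (V (r j)) u) atTop (𝓝 l) := by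
  obtain ⟨hvN, huN, hlim⟩ := hv
  obtain ⟨K, hK⟩ := exists_netEnergy_le hdoub hpoin
  have hint : ∀ {f : X → ℝ}, f ∈ N12 μ → ∀ (j : ℕ) (x : X),
      IntegrableOn f (ball x (r j / 4)) μ :=
    fun hf j x => integrableOn_ball_of_memLp hdoub hf.1 x _
  have hc : Tendsto (fun j => K * upperEnergy μ (v j - u)) atTop (𝓝 0) := by
    have := ENNReal.Tendsto.const_mul (tendsto_N12norm_zero_iff.1 hlim).2
      (Or.inr (ENNReal.coe_ne_top (r := K)))
    rwa [mul_zero] at this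
  have hvu : ∀ j, netEnergy μ (r j) (V (r j)) (v j) ^ (1 / 2 : ℝ) ≤
      netEnergy μ (r j) (V (r j)) u ^ (1 / 2 : ℝ) +
        (K * upperEnergy μ (v j - u)) ^ (1 / 2 : ℝ) := by
    intro j
    have hd := sub_mem_N12 (hvN j) huN
    have h1 := sqrt_netEnergy_le_add (V (r j)) (hint huN j) (hint hd j)
    rw [add_sub_cancel] at h1
    refine h1.trans (add_le_add le_rfl (ENNReal.rpow_le_rpow ?_ (by norm_num)))
    exact hK _ (hr j) _ (hV _ (hr j)) _ hd.1
  have huv : ∀ j, netEnergy μ (r j) (V (r j)) u ^ (1 / 2 : ℝ) ≤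
      netEnergy μ (r j) (V (r j)) (v j) ^ (1 / 2 : ℝ) +
        (K * upperEnergy μ (v j - u)) ^ (1 / 2 : ℝ) := by
    intro j
    have hd := neg_mem_N12 (sub_mem_N12 (hvN j) huN)
    have h1 := sqrt_netEnergy_le_add (V (r j)) (hint (hvN j) j) (hint hd j)
    rw [neg_sub, add_sub_cancel] at h1
    refine h1.trans (add_le_add le_rfl (ENNReal.rpow_le_rpow ?_ (by norm_num)))
    rw [← neg_sub]
    refine (hK _ (hr j) _ (hV _ (hr j)) _ hd.1).trans ?_
    gcongr
    exact upperEnergy_neg_le _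
  exact ⟨fun h => tendsto_of_sqrt_le h hc hvu huv, fun h => tendsto_of_sqrt_le h hc huv hvu⟩

/-- Truncating `v j` between `u - w` and `u + w` with `w = dist(·, X ∖ U)`, for an open set `U` of
finite measure: the result agrees with `u` off `U` and still converges to `u`. -/
theorem truncation_tendstoN12 {U : Set X} (hμ : μ U ≠ ∞) {v : ℕ → X → ℝ} {u : X → ℝ}
    (hv : TendstoN12 μ v u) {u' : ℕ → X → ℝ}
    (hu' : ∀ j x, u' j x = min (max (u x - infDist x Uᶜ) (v j x)) (u x + infDist x Uᶜ)) :
    TendstoN12 μ u' u ∧ ∀ j, u - u' j ∈ N12zero μ U := by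
  obtain ⟨hvN, huN, hlim⟩ := hv
  set w : X → ℝ := fun x => infDist x Uᶜ with hw
  have hw0 : ∀ x, 0 ≤ w x := fun x => infDist_nonneg
  have hwl : ∀ x y, |w x - w y| ≤ dist x y := fun x y => by
    simpa [Real.dist_eq] using (lipschitz_infDist_pt Uᶜ).dist_le_mul x y
  have hwz : ∀ x ∉ U, w x = 0 := fun x hx => infDist_zero_of_mem hx
  have hwμ : μ {x | 0 < w x} ≠ ∞ := by
    refine ne_top_of_le_ne_top hμ (measure_mono fun x hx => ?_)
    by_contra h
    exact absurd (hwz x h) (ne_of_gt hx)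
  have hd : ∀ j, v j - u ∈ N12 μ := fun j => sub_mem_N12 (hvN j) huN
  have e : ∀ j, u' j - u = fun x => clamp (w x) ((v j - u) x) := by
    intro j
    funext x
    simp only [Pi.sub_apply, hu', clamp, hw]
    grind
  have hN : ∀ j, u' j - u ∈ N12 μ := fun j => by
    rw [e]
    exact clamp_mem_N12 hw0 hwl hwμ (hd j)
  refine ⟨⟨fun j => ?_, huN, ?_⟩, fun j => ⟨?_, fun x hx => ?_⟩⟩
  · rw [← sub_add_cancel (u' j) u]
    exact add_mem_N12 (hN j) huN
  · simp only [e]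
    exact tendsto_N12norm_clamp hw0 hwl hwμ hd hlim
  · rw [← neg_sub]
    exact neg_mem_N12 (hN j)
  · rw [← neg_sub, Pi.neg_apply, e]
    simp only [hwz x hx, clamp_zero_left, neg_zero]

end Truncation

end GraphDirichlet

end

theorem theorem1p2 {X : Type*} [MetricSpace X] [CompleteSpace X]
    [MeasurableSpace X] [BorelSpace X]
    (hgeo : GraphDirichlet.IsGeodesicSpace X)
    (μ : Measure X) [IsLocallyFiniteMeasure μ] [μ.IsOpenPosMeasure]
    (hdoub : GraphDirichlet.IsDoubling μ)
    (hpoin : GraphDirichlet.SupportsPoincare μ)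
    (V : ℝ → Set X) (hV : ∀ r : ℝ, 0 < r → GraphDirichlet.IsNet r (V r))
    (r : ℕ → ℝ) (hr_pos : ∀ k, 0 < r k) (hr_lim : Tendsto r atTop (𝓝 0))
    (E : (X → ℝ) → ℝ≥0∞)
    (hE : GraphDirichlet.GammaConverges μ
      (fun k => GraphDirichlet.netEnergy μ (r k) (V (r k))) E)
    (Ω : Set X) (hΩ : GraphDirichlet.IsDomainSet Ω)
    (u : X → ℝ) (hu : u ∈ GraphDirichlet.N12 μ)
    (v : ℕ → X → ℝ) (hv : GraphDirichlet.TendstoN12 μ v u)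
    (hvE : Tendsto (fun j => GraphDirichlet.netEnergy μ (r j) (V (r j)) (v j)) atTop
      (𝓝 (E u))) :
    ∃ u' : ℕ → X → ℝ,
      (∀ j, u' j ∈ GraphDirichlet.N12 μ) ∧
      Tendsto (fun j => GraphDirichlet.netEnergy μ (r j) (V (r j)) (u' j)) atTop
        (𝓝 (E u)) ∧
      (∀ j, u - u' j ∈ GraphDirichlet.N12zero μ Ω) ∧
      GraphDirichlet.TendstoN12 μ u' u ∧
      (Ω ≠ univ → μ Ω < ∞ → ∀ j x,
        u' j x = min (max (u x - infDist x Ωᶜ) (v j x)) (u x + infDist x Ωᶜ)) := by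
  have energy : ∀ u' : ℕ → X → ℝ, GraphDirichlet.TendstoN12 μ u' u →
      Tendsto (fun j => GraphDirichlet.netEnergy μ (r j) (V (r j)) (u' j)) atTop (𝓝 (E u)) :=
    fun u' hu' => (GraphDirichlet.tendsto_netEnergy_iff hdoub hpoin hV hr_pos hu' _).2
      ((GraphDirichlet.tendsto_netEnergy_iff hdoub hpoin hV hr_pos hv _).1 hvE)
  by_cases huniv : Ω = univ
  · refine ⟨v, hv.1, hvE, fun j => ⟨GraphDirichlet.sub_mem_N12 hu (hv.1 j), fun x hx => ?_⟩, hv,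
      fun h => absurd huniv h⟩
    exact absurd (huniv ▸ mem_univ x) hx
  -- Truncation is performed on `Ω` if its measure is finite, and on a bounded part otherwise.
  obtain ⟨U, hUΩ, hUμ, hU⟩ : ∃ U ⊆ Ω, μ U ≠ ∞ ∧ (μ Ω < ∞ → U = Ω) := by
    by_cases hμ : μ Ω < ∞
    · exact ⟨Ω, Subset.rfl, hμ.ne, fun _ => rfl⟩
    · obtain ⟨x₀, -⟩ := hΩ.2.nonempty
      exact ⟨Ω ∩ ball x₀ 1, inter_subset_left, ne_top_of_le_ne_top
        (GraphDirichlet.measure_ball_lt_top hdoub x₀ 1).ne (measure_mono inter_subset_right),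
        fun h => absurd h hμ⟩
  obtain ⟨hlim, hzero⟩ := GraphDirichlet.truncation_tendstoN12 hUμ hv
    (u' := fun j x => min (max (u x - infDist x Uᶜ) (v j x)) (u x + infDist x Uᶜ))
    fun _ _ => rfl
  refine ⟨_, hlim.1, energy _ hlim, fun j => ⟨(hzero j).1, fun x hx => (hzero j).2 x
    fun h => hx (hUΩ h)⟩, hlim, fun _ hμ j x => ?_⟩
  rw [hU hμ]
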